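/- Work with locally irreducible plane curve singularities over $\mathbb{C}$ (plane branches). Such a germ is given by its normalization $t\mapsto (x(t),y(t))$, where $x,y\in t\,\mathbb{C}[[t]]$ and the fraction field of the local ring $\{h(x(t),y(t)) : h\in\mathbb{C}[[X,Y]]\}$ is $\mathbb{C}((t))$. Its multiplicity is $\min(\operatorname{ord}_t x,\operatorname{ord}_t y)$. Its semigroup is $$\Gamma=\{\operatorname{ord}_t h(x(t),y(t)) : h\in \mathbb{C}[[X,Y]],\ h(x(t),y(t))\neq 0\}\subset\mathbb{Z}_{\ge 0},$$ with counting function $H:\mathbb{Z}\to\mathbb{Z}_{\ge 0}$, $H(k)=\#\{s\in\Gamma : s<k\}$. Its multiplicity sequence $[n_1,\dots,n_r]$ consists of the multiplicities of the branch and of its consecutive strict transforms under blowing up points, until the strict transform is smooth (the multiplicities $1$ at the end are omitted; the sequence is empty if the branch is smooth). For functions $F,G:\mathbb{Z}\to\mathbb{Z}_{\ge 0}$ let $$(F\diamond G)(j)=\min_{j_1+j_2=j}\{F(j_1)+G(j_2)\}\qquad(j_1,j_2,j\in\mathbb{Z}).$$ Theorem. Let $\nu,\overline\nu\ge 1$,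 and let two collections of locally irreducible plane curve singularities be given, with multiplicity sequences $$[n^{(1)}_1,\dots,n^{(1)}_{r_1}],\dots,[n^{(\nu)}_1,\dots,n^{(\nu)}_{r_\nu}]\quad\text{and}\quad [\overline n^{(1)}_1,\dots,\overline n^{(1)}_{\overline r_1}],\dots,[\overline n^{(\overline\nu)}_1,\dots,\overline n^{(\overline\nu)}_{\overline r_{\overline\nu}}],$$ and with semigroup counting functions $H_1,\dots,H_\nu$ and $\overline H_1,\dots,\overline H_{\overline\nu}$, respectively. If $$\{\{n^{(1)}_1,\dots,n^{(1)}_{r_1},\dots,n^{(\nu)}_1,\dots,n^{(\nu)}_{r_\nu}\}\}=\{\{\overline n^{(1)}_1,\dots,\overline n^{(1)}_{\overline r_1},\dots,\overline n^{(\overline\nu)}_1,\dots,\overline n^{(\overline\nu)}_{\overline r_{\overline\nu}}\}\}$$ as multisets, then, as functions on $\mathbb{Z}$, $$H_1\diamond\dots\diamond H_\nu=\overline H_1\diamond\dots\diamond\overline H_{\overline\nu}.$$ -/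

import Mathlib

/-- A locally irreducible plane curve singularity (a plane branch) at the origin of the complex
plane, given by its normalization `t ↦ (x(t), y(t))`: two power series without constant term such
that the local ring of all `h(x(t), y(t))` has the full field of Laurent series in `t` as its field
of fractions. As this ring contains a nonzero nonunit, this says that `t` is a quotient of two of
its elements. The zero germ `(0, 0)` and multiple coverings such as `(t ^ 2, t ^ 4)` are thereby
excluded; smooth branches are allowed. -/
structure PlaneBranch where
  /-- First coordinate of the parametrization. -/
  x : PowerSeries ℂ
  /-- Second coordinate of the parametrization. -/
  y : PowerSeries ℂ
  x_zero : PowerSeries.constantCoeff x = 0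
  y_zero : PowerSeries.constantCoeff y = 0
  birational : ∃ p q : MvPowerSeries (Fin 2) ℂ,
    (MvPowerSeries.subst ![x, y] q : PowerSeries ℂ) ≠ 0 ∧
      (PowerSeries.X : PowerSeries ℂ) * MvPowerSeries.subst ![x, y] q =
        MvPowerSeries.subst ![x, y] p

namespace PlaneBranch

/-- The restriction `h(x(t), y(t))` of a function germ `h` of the plane to the branch. -/
noncomputable def pullback (γ : PlaneBranch) (h : MvPowerSeries (Fin 2) ℂ) : PowerSeries ℂ :=
  MvPowerSeries.subst ![γ.x, γ.y] h

/-- The substitution in `pullback` is always legitimate. -/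
theorem hasSubst (γ : PlaneBranch) :
    MvPowerSeries.HasSubst (![γ.x, γ.y] : Fin 2 → PowerSeries ℂ) := by
  apply MvPowerSeries.hasSubst_of_constantCoeff_zero
  intro s
  fin_cases s
  · exact γ.x_zero
  · exact γ.y_zero

/-- The semigroup of the branch: the intersection multiplicities at the origin of the branch with
the germs of curves `h = 0` that do not contain it, that is, the orders in `t` of the nonzero
restrictions `h(x(t), y(t))`. -/
def semigroup (γ : PlaneBranch) : Set ℕ :=
  {n | ∃ h : MvPowerSeries (Fin 2) ℂ, (γ.pullback h).order = (n : ℕ∞)}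

/-- The counting function `k ↦ #{s ∈ Γ : s < k}` of the semigroup, on all integers. -/
noncomputable def countingFunction (γ : PlaneBranch) (k : ℤ) : ℕ :=
  {s : ℕ | s ∈ γ.semigroup ∧ (s : ℤ) < k}.ncard

/-- The multiplicity of the branch at the origin. -/
noncomputable def multiplicity (γ : PlaneBranch) : ℕ :=
  (min γ.x.order γ.y.order).toNat

/-- `γ'` is the strict transform of `γ` under the blowup of the origin, in one of the two standard
charts `(u, v) ↦ (u, u * v)` and `(u, v) ↦ (u * v, v)` of the blowup, recentred at the point where
the strict transform meets the exceptional divisor. (If the orders of the two coordinates agree,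
both charts contain that point and either may be used.) -/
def IsBlowup (γ γ' : PlaneBranch) : Prop :=
  (∃ c : ℂ, γ'.x = γ.x ∧ γ.y = γ.x * (γ'.y + PowerSeries.C c)) ∨
    (∃ c : ℂ, γ'.y = γ.y ∧ γ.x = γ.y * (γ'.x + PowerSeries.C c))

/-- `HasMultiplicitySequence γ l`: the list `l` consists of the multiplicities of `γ` and of its
consecutive strict transforms under blowups of points, until the strict transform is smooth
(the multiplicities `1` at the end are omitted). -/
inductive HasMultiplicitySequence : PlaneBranch → List ℕ → Prop
  | smooth (γ : PlaneBranch) (h : γ.multiplicity = 1) : HasMultiplicitySequence γ []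
  | blowup (γ γ' : PlaneBranch) (l : List ℕ) (h : 1 < γ.multiplicity) (hb : IsBlowup γ γ')
      (hl : HasMultiplicitySequence γ' l) : HasMultiplicitySequence γ (γ.multiplicity :: l)

end PlaneBranch

/-- The minimum convolution `(F ◇ G)(j) = min {F(j₁) + G(j₂) : j₁ + j₂ = j}` of two functions from
the integers to the natural numbers. (The infimum is over a nonempty set of natural numbers, so it
is a minimum.) -/
noncomputable def minConv (F G : ℤ → ℕ) (j : ℤ) : ℕ :=
  sInf {n | ∃ j₁ j₂ : ℤ, j₁ + j₂ = j ∧ n = F j₁ + G j₂}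

/-- The iterated minimum convolution `H₀ ◇ H₁ ◇ ⋯ ◇ Hₙ` of `n + 1` functions. -/
noncomputable def iteratedMinConv : (n : ℕ) → (Fin (n + 1) → ℤ → ℕ) → ℤ → ℕ
  | 0, H => H 0
  | n + 1, H => minConv (iteratedMinConv n fun i => H i.castSucc) (H (Fin.last (n + 1)))

/-!
The counting function of a branch is determined by its multiplicity sequence through an explicit
formula in which only the multiset of multiplicities occurs. For a branch `γ` of multiplicity `n`
with strict transform `γ'`, the formula rests on
`H_γ(k) = min_a (a * (a + 1) / 2 + H_γ'(k - a * n))`,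
which says that `H_γ = E_n ◇ H_γ'`, where `E_n(j)` is the least value of `a * (a + 1) / 2` with
`a * n ≥ j` (`multiplicityCost`, `PlaneBranch.IsBlowup.countingFunction_eq`). For a smooth branch
`H(k) = max k 0`, and this function is idempotent under `◇`. Since `◇` is associative and
commutative, `H_1 ◇ ⋯ ◇ H_ν` is the convolution of the `E_n` for all multiplicities `n` that occur,
and of `max k 0` (`multisetCountingFunction`, `iteratedMinConv_eq_multisetCountingFunction`).

The recursion comes from Apéry's description of a blowup. Let `x` be the coordinate of order `n`,
and `y'` the other coordinate of the strict transform. There are polynomials `F_0, …, F_{n-1}`,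
with `F_i` monic of degree `i` in `y'` over `ℂ[x]`, whose orders `b_i` on `γ'` increase and are
pairwise incongruent modulo `n` (`ParamCurve.exists_isAperySystem`). They are built by removing
leading terms from `y' * F_{i-1}`; this stops at a new residue class, as otherwise all polynomials
would agree, up to terms of high order, with polynomials of degree less than `i < n` in `y'`, whose
orders fill only `i` classes, while birationality makes the semigroup meet all of them. The
semigroup of `γ'` consists of the numbers `b_i + n * m`
(`ParamCurve.IsAperySystem.exists_order_eq_iff`). With `y = x * (y' + c)`, the homogenized
polynomial `x ^ i * F_i` is monic of degree `i` in `y` over `ℂ[x]` and has order `b_i + n * i`, so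
that `γ` has the same kind of system (`ParamCurve.IsAperySystem.blowup`). If `c_i` is the number of
`m ≥ 0` with `b_i + n * m < k`, then `H_γ(k)` is the sum of the `max (c_i - i) 0`, and
`H_γ'(k - a * n)` that of the `max (c_i - a) 0`. As `c_i` does not increase with `i`, the recursion
is an elementary statement about such sums (`sum_tsub_le_choose_add`,
`exists_choose_add_le_sum_tsub`).
-/

/-! ### Polynomials in the two coordinates of a parametrization -/

namespace ParamCurve

open Polynomial

variable {K : Type*} [Field K]

/-- The restriction `P(x(t), y(t))` of a polynomial `P` in `K[X][Y]` to a parametrized curve. The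
inner variable is sent to `x`, the outer one to `y`. -/
noncomputable def eval₂Curve (x y : PowerSeries K) : K[X][X] →+* PowerSeries K :=
  eval₂RingHom (aeval x : K[X] →ₐ[K] PowerSeries K).toRingHom y

@[simp]
theorem eval₂Curve_C (x y : PowerSeries K) (a : K[X]) :
    eval₂Curve x y (C a) = aeval x a := by
  simp [eval₂Curve]

@[simp]
theorem eval₂Curve_X (x y : PowerSeries K) : eval₂Curve x y X = y := by
  simp [eval₂Curve]

theorem range_eval₂Curve (x y : PowerSeries K) :
    Set.range (eval₂Curve x y) = (Algebra.adjoin K {x, y} : Set (PowerSeries K)) := by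
  apply Set.Subset.antisymm
  · have hx : x ∈ Algebra.adjoin K {x, y} := Algebra.subset_adjoin (by simp)
    have hy : y ∈ Algebra.adjoin K {x, y} := Algebra.subset_adjoin (by simp)
    rintro _ ⟨P, rfl⟩
    induction P using Polynomial.induction_on' with
    | add p q hp hq => rw [map_add]; exact add_mem hp hq
    | monomial n a =>
      rw [← C_mul_X_pow_eq_monomial, map_mul, map_pow, eval₂Curve_C, eval₂Curve_X]
      refine mul_mem ?_ (pow_mem hy n)
      exact Algebra.adjoin_mono (by simp) (aeval_mem_adjoin_singleton K x)
  · intro f hf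
    induction hf using Algebra.adjoin_induction with
    | mem f hf =>
      rcases hf with rfl | rfl
      · exact ⟨C X, by simp⟩
      · exact ⟨X, by simp⟩
    | algebraMap r => exact ⟨C (C r), by simp⟩
    | add f g _ _ hf hg =>
      obtain ⟨P, rfl⟩ := hf
      obtain ⟨Q, rfl⟩ := hg
      exact ⟨P + Q, map_add _ _ _⟩
    | mul f g _ _ hf hg =>
      obtain ⟨P, rfl⟩ := hf
      obtain ⟨Q, rfl⟩ := hg
      exact ⟨P * Q, map_mul _ _ _⟩

theorem order_aeval {x : PowerSeries K} {n : ℕ} (hn : 0 < n) (hx : x.order = n) {a : K[X]}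
    (ha : a ≠ 0) : ∃ m : ℕ, (aeval x a).order = (n * m : ℕ) := by
  obtain ⟨q, hq, hd⟩ := exists_eq_pow_rootMultiplicity_mul_and_not_dvd a ha 0
  generalize rootMultiplicity 0 a = m at hq
  refine ⟨m, ?_⟩
  have hx0 : PowerSeries.constantCoeff x = 0 := by
    rw [← PowerSeries.order_ne_zero_iff_constCoeff_eq_zero, hx]
    exact_mod_cast hn.ne'
  have hq0 : (aeval x q).order = 0 := by
    by_contra h
    rw [← ne_eq, PowerSeries.order_ne_zero_iff_constCoeff_eq_zero, aeval_def, hom_eval₂, hx0,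
      eval₂_at_zero] at h
    rw [C_0, sub_zero, X_dvd_iff] at hd
    exact hd (by simpa using h)
  rw [hq]
  simp [hq0, hx, PowerSeries.order_mul, PowerSeries.order_pow, mul_comm]

/-- A power series can be corrected beyond its leading term by a multiple of any power series of
the same order. -/
theorem exists_lt_order_sub {f g : PowerSeries K} {N : ℕ} (hf : f.order = N) (hg : g.order = N) :
    ∃ c : K, ((N + 1 : ℕ) : ℕ∞) ≤ (f - PowerSeries.C c * g).order := by
  rw [PowerSeries.order_eq_nat] at hf hg
  refine ⟨PowerSeries.coeff N f / PowerSeries.coeff N g, PowerSeries.nat_le_order _ _ ?_⟩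
  intro i hi
  rw [map_sub, PowerSeries.coeff_C_mul]
  rcases Nat.lt_succ_iff_lt_or_eq.mp hi with h | rfl
  · rw [hf.2 i h, hg.2 i h, mul_zero, sub_zero]
  · rw [div_mul_cancel₀ _ hg.1, sub_self]

/-! ### Apéry systems -/

/-- An Apéry system of length `i` for the curve `(x, y)` modulo `n`: polynomials `F j` monic of
degree `j` in the second variable, for `j < i`, whose restrictions to the curve have finite
orders `b j` that increase strictly and are pairwise incongruent modulo `n`. The values of `F`
and `b` at indices `j ≥ i` are irrelevant. -/
structure IsAperySystem (x y : PowerSeries K) (n i : ℕ) (F : ℕ → K[X][X]) (b : ℕ → ℕ) :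
    Prop where
  monic : ∀ j < i, (F j).Monic
  natDegree : ∀ j < i, (F j).natDegree = j
  order : ∀ j < i, (eval₂Curve x y (F j)).order = b j
  lt : ∀ j k, j < k → k < i → b j < b k
  inj : ∀ j k, j < i → k < i → b j % n = b k % n → j = k

variable {x y : PowerSeries K} {n : ℕ} {F : ℕ → K[X][X]} {b : ℕ → ℕ}

theorem IsAperySystem.mono {i j : ℕ} (h : IsAperySystem x y n i F b) (hji : j ≤ i) :
    IsAperySystem x y n j F b where
  monic k hk := h.monic k (by omega)
  natDegree k hk := h.natDegree k (by omega)
  order k hk := h.order k (by omega)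
  lt k l hkl hl := h.lt k l hkl (by omega)
  inj k l hk hl := h.inj k l (by omega) (by omega)

/-- The orders of polynomials of degree less than `i` are governed by an Apéry system of
length `i`: such a polynomial is a combination of the `F j` with coefficients in `K[X]`, and the
nonzero terms of this combination have orders in different residue classes. -/
theorem IsAperySystem.order_of_degree_lt (hn : 0 < n) (hx : x.order = n) {i : ℕ}
    (h : IsAperySystem x y n i F b) {P : K[X][X]} (hP : P.degree < i)
    (hP0 : eval₂Curve x y P ≠ 0) :
    ∃ j < i, ∃ m, (eval₂Curve x y P).order = (b j + n * m : ℕ) := by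
  induction i generalizing P with
  | zero =>
    have : P = 0 := by simpa [Nat.WithBot.lt_zero_iff] using hP
    simp [this] at hP0
  | succ i ih =>
    have hi := h.natDegree i (Nat.lt_succ_self i)
    have hm := h.monic i (Nat.lt_succ_self i)
    set Q := P - C (P.coeff i) * F i with hQ
    have hQd : Q.degree < i := by
      rw [degree_lt_iff_coeff_zero] at hP ⊢
      intro k hk
      rw [hQ, coeff_sub, coeff_C_mul]
      rcases hk.lt_or_eq with hk | rfl
      · rw [hP k hk, coeff_eq_zero_of_natDegree_lt (p := F i) (by omega), mul_zero, sub_zero]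
      · have : (F i).coeff i = 1 := by
          have := hm.coeff_natDegree
          rwa [hi] at this
        rw [this, mul_one, sub_self]
    have hPQ : eval₂Curve x y P = eval₂Curve x y Q + aeval x (P.coeff i) * eval₂Curve x y (F i) := by
      rw [hQ, map_sub, map_mul, eval₂Curve_C, sub_add_cancel]
    by_cases ha : P.coeff i = 0
    · rw [ha, map_zero, zero_mul, add_zero] at hPQ
      rw [hPQ] at hP0 ⊢
      obtain ⟨j, hj, m, hjm⟩ := ih (h.mono (Nat.le_succ i)) hQd hP0
      exact ⟨j, by omega, m, hjm⟩
    · obtain ⟨m, hm⟩ := order_aeval hn hx ha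
      have ho : (aeval x (P.coeff i) * eval₂Curve x y (F i)).order = (b i + n * m : ℕ) := by
        rw [PowerSeries.order_mul, hm, h.order i (Nat.lt_succ_self i), add_comm, Nat.cast_add]
      by_cases hQ0 : eval₂Curve x y Q = 0
      · exact ⟨i, Nat.lt_succ_self i, m, by rw [hPQ, hQ0, zero_add, ho]⟩
      obtain ⟨j, hj, l, hjl⟩ := ih (h.mono (Nat.le_succ i)) hQd hQ0
      have hne : b j + n * l ≠ b i + n * m := by
        intro he
        have := congrArg (· % n) he
        simp only [Nat.add_mul_mod_self_left] at this
        have := h.inj j i (by omega) (by omega) this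
        omega
      have hadd := PowerSeries.order_add_of_order_ne (eval₂Curve x y Q)
        (aeval x (P.coeff i) * eval₂Curve x y (F i)) (by rw [hjl, ho]; exact_mod_cast hne)
      rw [← hPQ, hjl, ho] at hadd
      rcases le_total (b j + n * l) (b i + n * m) with hle | hle
      · exact ⟨j, by omega, l, by rw [hadd, min_eq_left (by exact_mod_cast hle)]⟩
      · exact ⟨i, by omega, m, by rw [hadd, min_eq_right (by exact_mod_cast hle)]⟩

/-- If every large enough order of a monic polynomial of degree `i` is of the form `b j + n * m`,
then there are monic polynomials of degree `i` of arbitrarily large order: leading terms are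
removed one after the other by subtracting multiples of `x ^ m * F j`. -/
theorem IsAperySystem.exists_monic_le_order (hx : x.order = n)
    (hy : PowerSeries.constantCoeff y = 0) {i : ℕ} (h : IsAperySystem x y n (i + 1) F b)
    (hs : ∀ (P : K[X][X]) (s : ℕ), P.Monic → P.natDegree = i + 1 → b i < s →
      (eval₂Curve x y P).order = s → ∃ j < i + 1, s % n = b j % n) (N : ℕ) :
    ∃ P : K[X][X], P.Monic ∧ P.natDegree = i + 1 ∧ (b i : ℕ∞) < (eval₂Curve x y P).order ∧
      (N : ℕ∞) ≤ (eval₂Curve x y P).order := by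
  have hmi := h.monic i (Nat.lt_succ_self i)
  induction N with
  | zero =>
    refine ⟨X * F i, monic_X.mul hmi, ?_, ?_, by simp⟩
    · rw [monic_X.natDegree_mul hmi, natDegree_X, h.natDegree i (Nat.lt_succ_self i), add_comm]
    · have hy1 : 1 ≤ y.order := PowerSeries.one_le_order_iff_constCoeff_eq_zero.mpr hy
      rw [map_mul, PowerSeries.order_mul, eval₂Curve_X, h.order i (Nat.lt_succ_self i)]
      calc (b i : ℕ∞) < 1 + b i := by
            rw [add_comm]; exact_mod_cast Nat.lt_succ_self (b i)
        _ ≤ _ := by gcongr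
  | succ N ih =>
    obtain ⟨P, hPm, hPd, hPb, hPN⟩ := ih
    rcases hPN.lt_or_eq with hlt | heq
    · refine ⟨P, hPm, hPd, hPb, ?_⟩
      rw [Nat.cast_add, Nat.cast_one]
      exact Order.add_one_le_of_lt hlt
    · have hbN : b i < N := by rw [← heq] at hPb; exact_mod_cast hPb
      obtain ⟨j, hj, hjN⟩ := hs P N hPm hPd hbN heq.symm
      have hbj : b j ≤ b i := by
        rcases (Nat.lt_succ_iff.mp hj).lt_or_eq with hlt | rfl
        · exact (h.lt j i hlt (Nat.lt_succ_self i)).le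
        · exact le_rfl
      obtain ⟨m, hm⟩ : n ∣ N - b j := (Nat.modEq_iff_dvd' (by omega)).mp hjN.symm
      have hg : (x ^ m * eval₂Curve x y (F j)).order = N := by
        rw [PowerSeries.order_mul, PowerSeries.order_pow, hx, h.order j hj, nsmul_eq_mul]
        have : N = m * n + b j := by rw [mul_comm]; omega
        exact_mod_cast this.symm
      obtain ⟨c, hc⟩ := exists_lt_order_sub heq.symm hg
      have hdeg : (C (C c * X ^ m) * F j).degree < P.degree := by
        rw [degree_eq_natDegree hPm.ne_zero, hPd]
        refine (degree_mul_le _ _).trans_lt ?_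
        calc (C (C c * X ^ m)).degree + (F j).degree ≤ 0 + (F j).degree := by
              gcongr; exact degree_C_le
          _ = (j : WithBot ℕ) := by
              rw [zero_add, degree_eq_natDegree (h.monic j hj).ne_zero, h.natDegree j hj]
          _ < _ := by exact_mod_cast hj
      have he : eval₂Curve x y (P - C (C c * X ^ m) * F j) =
          eval₂Curve x y P - PowerSeries.C c * (x ^ m * eval₂Curve x y (F j)) := by
        simp [mul_assoc]
      refine ⟨P - C (C c * X ^ m) * F j, hPm.sub_of_left hdeg, ?_, ?_, ?_⟩
      · rw [natDegree_eq_of_degree_eq (degree_sub_eq_left_of_degree_lt hdeg), hPd]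
      · rw [he]
        refine lt_of_lt_of_le ?_ hc
        exact_mod_cast hbN.trans (Nat.lt_succ_self N)
      · rw [he]; exact hc

/-- Either an Apéry system can be extended by one more polynomial, or it already accounts for the
orders of all polynomials: in the second case every polynomial may be replaced, up to terms of
arbitrarily high order, by its remainder modulo a monic polynomial of degree `i + 1`. -/
theorem IsAperySystem.extend_or_complete (hn : 0 < n) (hx : x.order = n)
    (hy : PowerSeries.constantCoeff y = 0) {i : ℕ} (h : IsAperySystem x y n (i + 1) F b) :
    (∃ (P : K[X][X]) (s : ℕ), P.Monic ∧ P.natDegree = i + 1 ∧ b i < s ∧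
      (eval₂Curve x y P).order = s ∧ ∀ j < i + 1, s % n ≠ b j % n) ∨
    ∀ (P : K[X][X]) (s : ℕ), (eval₂Curve x y P).order = s →
      ∃ j < i + 1, ∃ m, s = b j + n * m := by
  refine or_iff_not_imp_left.mpr fun hno P s hs ↦ ?_
  push Not at hno
  obtain ⟨G, hGm, hGd, -, hGs⟩ := h.exists_monic_le_order hx hy hno (s + 1)
  have hlt : (s : ℕ∞) < (eval₂Curve x y (-(G * (P /ₘ G)))).order := by
    rw [map_neg, PowerSeries.order_neg, map_mul, PowerSeries.order_mul]
    calc (s : ℕ∞) < (s + 1 : ℕ) := by exact_mod_cast Nat.lt_succ_self s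
      _ ≤ _ := hGs
      _ ≤ _ := le_self_add
  have hrem : (eval₂Curve x y (P %ₘ G)).order = s := by
    have hsum : P %ₘ G = P + -(G * (P /ₘ G)) := by
      rw [← sub_eq_add_neg, eq_sub_iff_add_eq, modByMonic_add_div]
    rw [hsum, map_add, PowerSeries.order_add_of_order_ne _ _ (by rw [hs]; exact hlt.ne), hs,
      min_eq_left hlt.le]
  have hdeg : (P %ₘ G).degree < (i + 1 : ℕ) := by
    have := degree_modByMonic_lt P hGm
    rwa [degree_eq_natDegree hGm.ne_zero, hGd] at this
  obtain ⟨j, hj, m, hm⟩ := h.order_of_degree_lt hn hx hdeg (by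
    rw [← PowerSeries.order_finite_iff_ne_zero, hrem]; exact ENat.natCast_lt_top s)
  exact ⟨j, hj, m, by rw [hrem] at hm; exact_mod_cast hm⟩

/-- Apéry systems of length up to `n` exist as soon as the orders of polynomials cover all
residue classes modulo `n`. -/
theorem exists_isAperySystem (hn : 0 < n) (hx : x.order = n)
    (hy : PowerSeries.constantCoeff y = 0)
    (hres : ∀ r, ∃ (P : K[X][X]) (s : ℕ), (eval₂Curve x y P).order = s ∧ s % n = r % n) :
    ∃ F b, IsAperySystem x y n n F b := by
  suffices ∀ i < n, ∃ F b, IsAperySystem x y n (i + 1) F b by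
    simpa [Nat.sub_add_cancel hn] using this (n - 1) (by omega)
  intro i
  induction i with
  | zero =>
    refine fun _ ↦ ⟨fun _ ↦ 1, fun _ ↦ 0, ?_, ?_, ?_, ?_, ?_⟩
    · exact fun _ _ ↦ monic_one
    · intro j hj
      simp [Nat.lt_one_iff.mp hj]
    · simp
    · omega
    · omega
  | succ i ih =>
    intro hi
    obtain ⟨F, b, h⟩ := ih (by omega)
    rcases h.extend_or_complete hn hx hy with ⟨P, s, hPm, hPd, hbs, hPs, hmod⟩ | hall
    · refine ⟨Function.update F (i + 1) P, Function.update b (i + 1) s, ?_, ?_, ?_, ?_, ?_⟩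
      · intro j hj
        rcases (Nat.lt_succ_iff.mp hj).lt_or_eq with hj | rfl
        · simpa [hj.ne] using h.monic j hj
        · simpa using hPm
      · intro j hj
        rcases (Nat.lt_succ_iff.mp hj).lt_or_eq with hj | rfl
        · simpa [hj.ne] using h.natDegree j hj
        · simpa using hPd
      · intro j hj
        rcases (Nat.lt_succ_iff.mp hj).lt_or_eq with hj | rfl
        · simpa [hj.ne] using h.order j hj
        · simpa using hPs
      · intro j k hjk hk
        rcases (Nat.lt_succ_iff.mp hk).lt_or_eq with hk | rfl
        · simpa [hk.ne, (hjk.trans hk).ne] using h.lt j k hjk hk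
        · rw [Function.update_self, Function.update_of_ne hjk.ne]
          rcases (Nat.lt_succ_iff.mp hjk).lt_or_eq with hj | rfl
          · exact (h.lt j i hj (Nat.lt_succ_self i)).trans hbs
          · exact hbs
      · intro j k hj hk
        rcases (Nat.lt_succ_iff.mp hj).lt_or_eq with hj | rfl <;>
          rcases (Nat.lt_succ_iff.mp hk).lt_or_eq with hk | rfl
        · simpa [hk.ne, hj.ne] using h.inj j k hj hk
        · intro he
          simp only [Function.update_self, Function.update_of_ne hj.ne] at he
          exact absurd he.symm (hmod j hj)
        · intro he
          simp only [Function.update_self, Function.update_of_ne hk.ne] at he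
          exact absurd he (hmod k hk)
        · exact fun _ ↦ rfl
    · have hsub : Finset.range n ⊆ (Finset.range (i + 1)).image fun j ↦ b j % n := by
        intro r hr
        obtain ⟨P, s, hs, hsr⟩ := hres r
        obtain ⟨j, hj, m, rfl⟩ := hall P s hs
        rw [Finset.mem_image]
        refine ⟨j, Finset.mem_range.mpr hj, ?_⟩
        rwa [Nat.add_mul_mod_self_left, Nat.mod_eq_of_lt (Finset.mem_range.mp hr)] at hsr
      have := (Finset.card_le_card hsub).trans Finset.card_image_le
      simp only [Finset.card_range] at this
      omega

/-- The orders attained by an Apéry system of full length `n` form an Apéry set: the orders of all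
polynomials are the numbers `b j + n * m`. -/
theorem IsAperySystem.exists_order_eq_iff (hn : 0 < n) (hx : x.order = n)
    (hy : PowerSeries.constantCoeff y = 0) (h : IsAperySystem x y n n F b) (s : ℕ) :
    (∃ P, (eval₂Curve x y P).order = s) ↔ ∃ j < n, ∃ m, s = b j + n * m := by
  constructor
  · rintro ⟨P, hP⟩
    obtain ⟨i, rfl⟩ : ∃ i, n = i + 1 := ⟨n - 1, by omega⟩
    rcases h.extend_or_complete hn hx hy with ⟨-, r, -, -, -, -, hmod⟩ | hall
    · exfalso
      have himg : (Finset.range (i + 1)).image (fun j ↦ b j % (i + 1)) = Finset.range (i + 1) := by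
        apply Finset.eq_of_subset_of_card_le
        · intro r hr
          obtain ⟨j, -, rfl⟩ := Finset.mem_image.mp hr
          exact Finset.mem_range.mpr (Nat.mod_lt _ hn)
        · rw [Finset.card_image_of_injOn]
          intro j hj k hk hjk
          exact h.inj j k (by simpa using hj) (by simpa using hk) hjk
      have hr : r % (i + 1) ∈ Finset.range (i + 1) := Finset.mem_range.mpr (Nat.mod_lt _ hn)
      rw [← himg] at hr
      obtain ⟨j, hj, hjr⟩ := Finset.mem_image.mp hr
      exact hmod j (Finset.mem_range.mp hj) hjr.symm
    · exact hall P s hP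
  · rintro ⟨j, hj, m, rfl⟩
    refine ⟨C (X ^ m) * F j, ?_⟩
    rw [map_mul, eval₂Curve_C, map_pow, aeval_X, PowerSeries.order_mul, PowerSeries.order_pow, hx,
      h.order j hj, nsmul_eq_mul]
    push_cast
    ring

/-- Apéry's theorem on blowups: homogenizing an Apéry system of the strict transform `(x, y)`
yields one of the original curve `(x, x * (y + c))`, with orders increased by `i * n` in
degree `i`. -/
theorem IsAperySystem.blowup (hx : x.order = n) {i : ℕ} (h : IsAperySystem x y n i F b) (c : K) :
    IsAperySystem x (x * (y + PowerSeries.C c)) n i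
      (fun j ↦ ((F j).comp (X - C (C c))).scaleRoots X) (fun j ↦ b j + n * j) where
  monic j hj := by
    rw [monic_scaleRoots_iff]
    exact (h.monic j hj).comp (monic_X_sub_C _) (by rw [natDegree_X_sub_C]; exact one_ne_zero)
  natDegree j hj := by
    rw [natDegree_scaleRoots, natDegree_comp, natDegree_X_sub_C, mul_one, h.natDegree j hj]
  order j hj := by
    have he : eval₂Curve x (x * (y + PowerSeries.C c))
        (((F j).comp (X - C (C c))).scaleRoots X) = x ^ j * eval₂Curve x y (F j) := by
      have hs := scaleRoots_eval₂_mul (p := (F j).comp (X - C (C c)))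
        (aeval x : K[X] →ₐ[K] PowerSeries K).toRingHom (y + PowerSeries.C c) X
      have hX : (aeval x : K[X] →ₐ[K] PowerSeries K).toRingHom X = x := aeval_X x
      rw [hX, natDegree_comp, natDegree_X_sub_C, mul_one, h.natDegree j hj, eval₂_comp] at hs
      simpa [eval₂Curve, PowerSeries.algebraMap_apply] using hs
    rw [he, PowerSeries.order_mul, PowerSeries.order_pow, hx, h.order j hj, nsmul_eq_mul]
    push_cast
    ring
  lt j k hjk hk := Nat.add_lt_add_of_lt_of_le (h.lt j k hjk hk) (Nat.mul_le_mul_left n hjk.le)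
  inj j k hj hk he := by
    simp only [Nat.add_mul_mod_self_left] at he
    exact h.inj j k hj hk he

end ParamCurve

/-! ### The minimum convolution -/

theorem minConv_le_iff {F G : ℤ → ℕ} {j : ℤ} {N : ℕ} :
    minConv F G j ≤ N ↔ ∃ j₁ j₂ : ℤ, j₁ + j₂ = j ∧ F j₁ + G j₂ ≤ N := by
  constructor
  · intro h
    have hne : {n | ∃ j₁ j₂ : ℤ, j₁ + j₂ = j ∧ n = F j₁ + G j₂}.Nonempty :=
      ⟨_, j, 0, add_zero j, rfl⟩
    obtain ⟨j₁, j₂, hj, he⟩ := Nat.sInf_mem hne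
    exact ⟨j₁, j₂, hj, he ▸ h⟩
  · rintro ⟨j₁, j₂, hj, he⟩
    have hle : minConv F G j ≤ F j₁ + G j₂ := Nat.sInf_le ⟨j₁, j₂, hj, rfl⟩
    exact hle.trans he

theorem minConv_comm (F G : ℤ → ℕ) : minConv F G = minConv G F := by
  funext j
  refine eq_of_forall_ge_iff fun N ↦ ?_
  rw [minConv_le_iff, minConv_le_iff, exists_comm]
  simp only [add_comm]

theorem minConv_assoc (F G H : ℤ → ℕ) : minConv (minConv F G) H = minConv F (minConv G H) := by
  funext j
  refine eq_of_forall_ge_iff fun N ↦ ?_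
  rw [minConv_le_iff, minConv_le_iff]
  constructor
  · rintro ⟨j₁, j₂, hj, hN⟩
    obtain ⟨k₁, k₂, hk, hM⟩ := minConv_le_iff.mp (le_refl (minConv F G j₁))
    refine ⟨k₁, k₂ + j₂, by omega, ?_⟩
    have := minConv_le_iff.mpr ⟨k₂, j₂, rfl, le_refl (G k₂ + H j₂)⟩
    omega
  · rintro ⟨j₁, j₂, hj, hN⟩
    obtain ⟨k₁, k₂, hk, hM⟩ := minConv_le_iff.mp (le_refl (minConv G H j₂))
    refine ⟨j₁ + k₁, k₂, by omega, ?_⟩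
    have := minConv_le_iff.mpr ⟨j₁, k₁, rfl, le_refl (F j₁ + G k₁)⟩
    omega

theorem minConv_toNat_toNat : minConv Int.toNat Int.toNat = Int.toNat := by
  funext j
  refine eq_of_forall_ge_iff fun N ↦ ?_
  rw [minConv_le_iff]
  constructor
  · rintro ⟨j₁, j₂, hj, hN⟩
    omega
  · exact fun h ↦ ⟨j, 0, add_zero j, by simpa using h⟩

/-- The least number of conditions by which a multiplicity at a point of multiplicity `n` of a
branch raises intersection numbers by at least `j`: the minimum of `a * (a + 1) / 2`, the number
of conditions for a plane curve to have multiplicity `a` at a given point, over the `a` with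
`j ≤ a * n`. It is meant for `n > 0`; the triangular number is written as a binomial
coefficient. -/
noncomputable def multiplicityCost (n : ℕ) (j : ℤ) : ℕ :=
  sInf {N | ∃ a : ℕ, j ≤ a * n ∧ N = (a + 1).choose 2}

theorem multiplicityCost_le_iff {n : ℕ} (hn : 0 < n) {j : ℤ} {N : ℕ} :
    multiplicityCost n j ≤ N ↔ ∃ a : ℕ, j ≤ a * n ∧ (a + 1).choose 2 ≤ N := by
  constructor
  · intro h
    have hne : {N | ∃ a : ℕ, j ≤ a * n ∧ N = (a + 1).choose 2}.Nonempty := by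
      refine ⟨_, j.toNat, ?_, rfl⟩
      have : j.toNat ≤ j.toNat * n := Nat.le_mul_of_pos_right _ hn
      have : (j.toNat : ℤ) ≤ j.toNat * n := by exact_mod_cast this
      omega
    obtain ⟨a, ha, he⟩ := Nat.sInf_mem hne
    exact ⟨a, ha, he ▸ h⟩
  · rintro ⟨a, ha, he⟩
    have hle : multiplicityCost n j ≤ (a + 1).choose 2 := Nat.sInf_le ⟨a, ha, rfl⟩
    exact hle.trans he

/-- The counting function attached to a multiset of multiplicities: the minimum convolution of
their costs and of the counting function `k ↦ max k 0` of a smooth branch. -/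
noncomputable def multisetCountingFunction (s : Multiset ℕ) : ℤ → ℕ :=
  haveI : LeftCommutative fun (n : ℕ) (F : ℤ → ℕ) ↦ minConv (multiplicityCost n) F :=
    ⟨fun a b F ↦ by rw [← minConv_assoc, ← minConv_assoc, minConv_comm (multiplicityCost a)]⟩
  s.foldr (fun n F ↦ minConv (multiplicityCost n) F) Int.toNat

@[simp]
theorem multisetCountingFunction_zero : multisetCountingFunction 0 = Int.toNat := by
  simp [multisetCountingFunction]

@[simp]
theorem multisetCountingFunction_cons (n : ℕ) (s : Multiset ℕ) :
    multisetCountingFunction (n ::ₘ s) =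
      minConv (multiplicityCost n) (multisetCountingFunction s) := by
  simp [multisetCountingFunction]

theorem multisetCountingFunction_add (s t : Multiset ℕ) :
    multisetCountingFunction (s + t) =
      minConv (multisetCountingFunction s) (multisetCountingFunction t) := by
  induction s using Multiset.induction_on with
  | empty =>
    rw [zero_add, multisetCountingFunction_zero]
    induction t using Multiset.induction_on with
    | empty => rw [multisetCountingFunction_zero, minConv_toNat_toNat]
    | cons n t ih =>
      rw [multisetCountingFunction_cons, ← minConv_assoc, minConv_comm Int.toNat, minConv_assoc,
        ← ih]
  | cons n s ih =>
    rw [Multiset.cons_add, multisetCountingFunction_cons, multisetCountingFunction_cons, ih,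
      minConv_assoc]

theorem iteratedMinConv_eq_multisetCountingFunction (ν : ℕ) (H : Fin (ν + 1) → ℤ → ℕ)
    (s : Fin (ν + 1) → Multiset ℕ) (h : ∀ i, H i = multisetCountingFunction (s i)) :
    iteratedMinConv ν H = multisetCountingFunction (∑ i, s i) := by
  induction ν with
  | zero => simp [iteratedMinConv, h]
  | succ ν ih =>
    rw [Fin.sum_univ_castSucc, multisetCountingFunction_add, iteratedMinConv, h,
      ih _ (fun i ↦ s i.castSucc) fun i ↦ h i.castSucc]

/-! ### Counting elements of a union of arithmetic progressions -/

theorem sum_range_tsub (a : ℕ) : ∑ i ∈ Finset.range a, (a - i) = (a + 1).choose 2 := by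
  have h := Finset.sum_range_reflect (fun i ↦ i + 1) a
  rw [Finset.sum_congr rfl (g := fun j ↦ a - 1 - j + 1)]
  · rw [h]
    induction a with
    | zero => rfl
    | succ a ih =>
      rw [Finset.sum_range_succ, ih (Finset.sum_range_reflect (fun i ↦ i + 1) a),
        Nat.choose_succ_succ' (a + 1), Nat.choose_one_right, add_comm]
  · intro i hi
    rw [Finset.mem_range] at hi
    omega

theorem sum_range_tsub_le (n a : ℕ) : ∑ i ∈ Finset.range n, (a - i) ≤ (a + 1).choose 2 := by
  rw [← sum_range_tsub a]
  rcases le_total n a with h | h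
  · exact Finset.sum_le_sum_of_subset (Finset.range_mono h)
  · refine (Finset.sum_subset (Finset.range_mono h) fun i _ hi ↦ ?_).ge
    rw [Finset.mem_range] at hi
    omega

theorem sum_tsub_le_choose_add (n a : ℕ) (c : ℕ → ℕ) :
    ∑ i ∈ Finset.range n, (c i - i) ≤ (a + 1).choose 2 + ∑ i ∈ Finset.range n, (c i - a) := by
  calc _ ≤ ∑ i ∈ Finset.range n, ((a - i) + (c i - a)) :=
        Finset.sum_le_sum fun i _ ↦ by omega
    _ ≤ _ := by
      rw [Finset.sum_add_distrib]
      gcongr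
      exact sum_range_tsub_le n a

/-- The bound of `sum_tsub_le_choose_add` is attained if `c` is antitone, at the point `a` where
the graph of `c` crosses the diagonal. -/
theorem exists_choose_add_le_sum_tsub (n : ℕ) (c : ℕ → ℕ)
    (hc : ∀ i j, i < j → j < n → c j ≤ c i) :
    ∃ a : ℕ, (a + 1).choose 2 + ∑ i ∈ Finset.range n, (c i - a) ≤
      ∑ i ∈ Finset.range n, (c i - i) := by
  have hex : ∃ a, n ≤ a ∨ c a ≤ a := ⟨n, Or.inl le_rfl⟩
  classical
  obtain ⟨a, ha, hmin⟩ : ∃ a, (n ≤ a ∨ c a ≤ a) ∧ ∀ i < a, ¬(n ≤ i ∨ c i ≤ i) :=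
    ⟨Nat.find hex, Nat.find_spec hex, fun i hi ↦ Nat.find_min hex hi⟩
  have han : a ≤ n := by
    by_contra hlt
    exact hmin n (by omega) (Or.inl le_rfl)
  have hlow : ∀ i < a, a ≤ c i := by
    intro i hi
    have h1 := hmin (a - 1) (by omega)
    have h2 : c (a - 1) ≤ c i := by
      rcases (Nat.le_sub_one_of_lt hi).lt_or_eq with h | h
      · exact hc _ _ h (by omega)
      · rw [h]
    omega
  have hhigh : ∀ i, a ≤ i → i < n → c i ≤ a := by
    intro i hai hin
    rcases hai.lt_or_eq with h | rfl
    · exact (hc a i h hin).trans (by omega)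
    · omega
  refine ⟨a, ?_⟩
  have hsum : ∑ i ∈ Finset.range n, (a - i) = (a + 1).choose 2 := by
    rw [← sum_range_tsub a]
    refine (Finset.sum_subset (Finset.range_mono han) fun i _ hi ↦ ?_).symm
    rw [Finset.mem_range] at hi
    omega
  rw [← hsum, ← Finset.sum_add_distrib]
  refine Finset.sum_le_sum fun i hi ↦ ?_
  rw [Finset.mem_range] at hi
  rcases lt_or_ge i a with h | h
  · have := hlow i h
    omega
  · have := hhigh i h hi
    omega

theorem ncard_progressions {n : ℕ} (hn : 0 < n) (b : ℕ → ℕ)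
    (hb : ∀ i j, i < n → j < n → b i % n = b j % n → i = j) (k : ℤ) :
    {s : ℕ | (∃ i < n, ∃ m, s = b i + n * m) ∧ (s : ℤ) < k}.ncard =
      ∑ i ∈ Finset.range n, ((k - b i + (n - 1)) / n).toNat := by
  have himg : {s : ℕ | (∃ i < n, ∃ m, s = b i + n * m) ∧ (s : ℤ) < k} =
      (fun p : (_ : ℕ) × ℕ ↦ b p.1 + n * p.2) ''
        ((Finset.range n).sigma fun i ↦ Finset.range ((k - b i + (n - 1)) / n).toNat) := by
    have key : ∀ i m : ℕ, ((b i + n * m : ℕ) : ℤ) < k ↔ m < ((k - b i + (n - 1)) / n).toNat := by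
      intro i m
      have hn' : (0 : ℤ) < n := by exact_mod_cast hn
      rw [Int.lt_toNat, ← Int.add_one_le_iff (a := (m : ℤ)), Int.le_ediv_iff_mul_le hn']
      push_cast
      constructor <;> intro h <;> nlinarith
    ext s
    simp only [Set.mem_ofPred_eq, Set.mem_image, Finset.mem_coe, Finset.mem_sigma, Finset.mem_range,
      Sigma.exists]
    constructor
    · rintro ⟨⟨i, hi, m, rfl⟩, hk⟩
      exact ⟨i, m, ⟨hi, (key i m).mp hk⟩, rfl⟩
    · rintro ⟨i, m, ⟨hi, hm⟩, rfl⟩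
      exact ⟨⟨i, hi, m, rfl⟩, (key i m).mpr hm⟩
  rw [himg, Set.InjOn.ncard_image, Set.ncard_coe_finset, Finset.card_sigma]
  · simp
  · rintro ⟨i, m⟩ hi ⟨j, l⟩ hj he
    simp only [Finset.mem_coe, Finset.mem_sigma, Finset.mem_range] at hi hj he
    have hmod := congrArg (· % n) he
    simp only [Nat.add_mul_mod_self_left] at hmod
    obtain rfl := hb i j hi.1 hj.1 hmod
    have : m = l := Nat.eq_of_mul_eq_mul_left hn (by omega)
    rw [this]

/-- The combinatorial form of the effect of a blowup: if the Apéry set is changed from `b i`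
to `b i + n * i`, then the counting function is convolved with the cost of a multiplicity `n`. -/
theorem sum_progressions_eq_minConv {n : ℕ} (hn : 0 < n) (b : ℕ → ℕ)
    (hb : ∀ i j, i < j → j < n → b i < b j) (k : ℤ) :
    ∑ i ∈ Finset.range n, ((k - (b i + n * i : ℕ) + (n - 1)) / n).toNat =
      minConv (multiplicityCost n)
        (fun k ↦ ∑ i ∈ Finset.range n, ((k - b i + (n - 1)) / n).toNat) k := by
  have hn' : (0 : ℤ) < n := by exact_mod_cast hn
  have hshift : ∀ (k : ℤ) (i a : ℕ), ((k - a * n - b i + (n - 1)) / n).toNat =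
      ((k - b i + (n - 1)) / n).toNat - a := by
    intro k i a
    rw [show k - a * n - b i + (n - 1) = k - b i + (n - 1) - a * n by ring,
      Int.sub_mul_ediv_right _ _ hn'.ne']
    omega
  have hleft : ∀ i : ℕ, ((k - (b i + n * i : ℕ) + (n - 1)) / n).toNat =
      ((k - b i + (n - 1)) / n).toNat - i := by
    intro i
    rw [← hshift]
    congr 2
    push_cast
    ring
  simp only [hleft]
  refine eq_of_forall_ge_iff fun N ↦ ?_
  rw [minConv_le_iff]
  constructor
  · intro h
    obtain ⟨a, ha⟩ := exists_choose_add_le_sum_tsub n (fun i ↦ ((k - b i + (n - 1)) / n).toNat)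
      fun i j hij hj ↦ by
        have := hb i j hij hj
        exact Int.toNat_le_toNat (Int.ediv_le_ediv hn' (by omega))
    refine ⟨a * n, k - a * n, by ring, ?_⟩
    simp only [hshift]
    have := (multiplicityCost_le_iff hn).mpr ⟨a, le_refl ((a : ℤ) * n), le_rfl⟩
    omega
  · rintro ⟨j₁, j₂, hj, hN⟩
    obtain ⟨a, haj, hac⟩ := (multiplicityCost_le_iff hn).mp (le_refl (multiplicityCost n j₁))
    have h1 := sum_tsub_le_choose_add n a fun i ↦ ((k - b i + (n - 1)) / n).toNat
    have h2 : ∑ i ∈ Finset.range n, (((k - b i + (n - 1)) / n).toNat - a) ≤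
        ∑ i ∈ Finset.range n, ((j₂ - b i + (n - 1)) / n).toNat := by
      refine Finset.sum_le_sum fun i _ ↦ ?_
      rw [← hshift]
      exact Int.toNat_le_toNat (Int.ediv_le_ediv hn' (by omega))
    omega

/-! ### The semigroup of a plane branch -/

namespace PlaneBranch

open ParamCurve

/-- Every element of the semigroup is the order of a polynomial in the coordinates: the monomials
whose exponent in some variable exceeds `s` contribute nothing up to order `s`. -/
theorem exists_mvPolynomial_order_eq (γ : PlaneBranch) {h : MvPowerSeries (Fin 2) ℂ} {s : ℕ}
    (hs : (γ.pullback h).order = s) :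
    ∃ p : MvPolynomial (Fin 2) ℂ, (MvPolynomial.aeval ![γ.x, γ.y] p).order = s := by
  set N : Fin 2 →₀ ℕ := Finsupp.equivFunOnFinite.symm fun _ ↦ s with hN
  refine ⟨MvPowerSeries.trunc' ℂ N h, ?_⟩
  have hcoeff : ∀ i ≤ s, PowerSeries.coeff i (MvPolynomial.aeval ![γ.x, γ.y]
      (MvPowerSeries.trunc' ℂ N h)) = PowerSeries.coeff i (γ.pullback h) := by
    intro i hi
    rw [← MvPowerSeries.subst_coe, pullback, PowerSeries.coeff, MvPowerSeries.coeff_subst γ.hasSubst,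
      MvPowerSeries.coeff_subst γ.hasSubst]
    refine finsum_congr fun d ↦ ?_
    rw [MvPolynomial.coeff_coe, MvPowerSeries.coeff_trunc']
    split_ifs with hd
    · rfl
    · rw [zero_smul]
      suffices MvPowerSeries.coeff (Finsupp.single () i)
          (d.prod fun s e ↦ (![γ.x, γ.y] s : PowerSeries ℂ) ^ e) = 0 by rw [this, smul_zero]
      change PowerSeries.coeff i (d.prod fun s e ↦ (![γ.x, γ.y] s : PowerSeries ℂ) ^ e) = 0
      apply PowerSeries.coeff_of_lt_order
      obtain ⟨l, hl⟩ : ∃ l, s < d l := by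
        by_contra! hcon
        exact hd fun l ↦ by simpa [hN] using hcon l
      have hone : 1 ≤ (![γ.x, γ.y] l : PowerSeries ℂ).order := by
        rw [PowerSeries.one_le_order_iff_constCoeff_eq_zero]
        fin_cases l
        · exact γ.x_zero
        · exact γ.y_zero
      have hl0 : l ∈ d.support := by
        rw [Finsupp.mem_support_iff]
        omega
      rw [Finsupp.prod, ← Finset.mul_prod_erase _ _ hl0, PowerSeries.order_mul,
        PowerSeries.order_pow, nsmul_eq_mul]
      calc (i : ℕ∞) < d l := by exact_mod_cast hi.trans_lt hl
        _ = d l * 1 := (mul_one _).symm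
        _ ≤ d l * (![γ.x, γ.y] l : PowerSeries ℂ).order := by gcongr
        _ ≤ _ := le_self_add
  rw [PowerSeries.order_eq_nat] at hs ⊢
  refine ⟨by rw [hcoeff s le_rfl]; exact hs.1, fun i hi ↦ ?_⟩
  rw [hcoeff i hi.le]
  exact hs.2 i hi

theorem mem_semigroup_iff_adjoin (γ : PlaneBranch) (s : ℕ) :
    s ∈ γ.semigroup ↔ ∃ f ∈ Algebra.adjoin ℂ {γ.x, γ.y}, f.order = s := by
  have hrange : Algebra.adjoin ℂ {γ.x, γ.y} = (MvPolynomial.aeval ![γ.x, γ.y]).range := by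
    rw [← Algebra.adjoin_range_eq_range_aeval, Matrix.range_cons, Matrix.range_cons,
      Matrix.range_empty, Set.union_empty, Set.singleton_union]
  rw [hrange]
  constructor
  · rintro ⟨h, hs⟩
    obtain ⟨p, hp⟩ := γ.exists_mvPolynomial_order_eq hs
    exact ⟨_, ⟨p, rfl⟩, hp⟩
  · rintro ⟨_, ⟨p, rfl⟩, hs⟩
    refine ⟨p, ?_⟩
    rw [pullback, MvPowerSeries.subst_coe]
    exact hs

theorem mem_semigroup_iff (γ : PlaneBranch) {x y : PowerSeries ℂ}
    (hxy : ({γ.x, γ.y} : Set (PowerSeries ℂ)) = {x, y}) (s : ℕ) :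
    s ∈ γ.semigroup ↔ ∃ P, (eval₂Curve x y P).order = s := by
  rw [mem_semigroup_iff_adjoin, hxy]
  constructor
  · rintro ⟨f, hf, hs⟩
    rw [← SetLike.mem_coe, ← range_eval₂Curve] at hf
    obtain ⟨P, rfl⟩ := hf
    exact ⟨P, hs⟩
  · rintro ⟨P, hs⟩
    refine ⟨_, ?_, hs⟩
    rw [← SetLike.mem_coe, ← range_eval₂Curve]
    exact ⟨P, rfl⟩

theorem add_mem_semigroup (γ : PlaneBranch) {s t : ℕ} (hs : s ∈ γ.semigroup)
    (ht : t ∈ γ.semigroup) : s + t ∈ γ.semigroup := by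
  rw [mem_semigroup_iff_adjoin] at *
  obtain ⟨f, hf, hfs⟩ := hs
  obtain ⟨g, hg, hgt⟩ := ht
  exact ⟨f * g, mul_mem hf hg, by rw [PowerSeries.order_mul, hfs, hgt, Nat.cast_add]⟩

theorem mul_mem_semigroup (γ : PlaneBranch) {s : ℕ} (hs : s ∈ γ.semigroup) (m : ℕ) :
    s * m ∈ γ.semigroup := by
  rw [mem_semigroup_iff_adjoin] at *
  obtain ⟨f, hf, hfs⟩ := hs
  exact ⟨f ^ m, pow_mem hf m, by
    rw [PowerSeries.order_pow, hfs, nsmul_eq_mul, Nat.cast_mul, mul_comm]⟩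

/-- Birationality of the parametrization provides two consecutive elements `s` and `s + 1` of the
semigroup, and `s * ((n - 1) * r) + (s + 1) * r` is congruent to `r` modulo `n`. -/
theorem exists_mem_semigroup_mod_eq (γ : PlaneBranch) {n : ℕ} (hn : 0 < n) (r : ℕ) :
    ∃ s ∈ γ.semigroup, s % n = r % n := by
  obtain ⟨p, q, hq, hpq⟩ := γ.birational
  obtain ⟨s, hs⟩ : ∃ s : ℕ, (γ.pullback q).order = s :=
    ⟨_, (PowerSeries.coe_toNat_order hq).symm⟩
  have hs' : s + 1 ∈ γ.semigroup := by
    refine ⟨p, ?_⟩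
    change PowerSeries.X * γ.pullback q = γ.pullback p at hpq
    rw [← hpq, PowerSeries.order_mul, PowerSeries.order_X, hs, Nat.cast_add, Nat.cast_one, add_comm]
  refine ⟨s * ((n - 1) * r) + (s + 1) * r,
    γ.add_mem_semigroup (γ.mul_mem_semigroup ⟨q, hs⟩ _) (γ.mul_mem_semigroup hs' _), ?_⟩
  have : s * ((n - 1) * r) + (s + 1) * r = r + n * (s * r) := by
    obtain ⟨m, rfl⟩ : ∃ m, n = m + 1 := ⟨n - 1, by omega⟩
    rw [Nat.add_sub_cancel]
    ring
  rw [this, Nat.add_mul_mod_self_left]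

/-! ### The effect of a blowup on the counting function -/

theorem countingFunction_of_multiplicity_eq_one (γ : PlaneBranch) (h : γ.multiplicity = 1) :
    γ.countingFunction = Int.toNat := by
  have h1 : 1 ∈ γ.semigroup := by
    rw [mem_semigroup_iff_adjoin]
    rw [multiplicity, ENat.toNat_eq_iff one_ne_zero] at h
    rcases min_choice γ.x.order γ.y.order with hm | hm <;> rw [hm] at h
    · exact ⟨γ.x, Algebra.subset_adjoin (by simp), h⟩
    · exact ⟨γ.y, Algebra.subset_adjoin (by simp), h⟩
  funext k
  have : {s : ℕ | s ∈ γ.semigroup ∧ (s : ℤ) < k} = Finset.range k.toNat := by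
    ext s
    have hs : s ∈ γ.semigroup := by simpa using γ.mul_mem_semigroup h1 s
    simp [hs, Int.lt_toNat]
  rw [countingFunction, this, Set.ncard_coe_finset, Finset.card_range]

/-- One blowup, in either chart: `x` is the coordinate of `γ` that generates the exceptional divisor
in the chart, and `y'` the other coordinate of the strict transform. As only the unordered pairs of
coordinates matter for the semigroups, both charts are instances of this statement. -/
theorem countingFunction_eq_minConv (γ γ' : PlaneBranch) {x y' : PowerSeries ℂ} {c : ℂ} {n : ℕ}
    (hn : 0 < n) (hx : x.order = n) (hy' : PowerSeries.constantCoeff y' = 0)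
    (hγ : ({γ.x, γ.y} : Set (PowerSeries ℂ)) = {x, x * (y' + PowerSeries.C c)})
    (hγ' : ({γ'.x, γ'.y} : Set (PowerSeries ℂ)) = {x, y'}) :
    γ.countingFunction = minConv (multiplicityCost n) γ'.countingFunction := by
  obtain ⟨F, b, h⟩ := exists_isAperySystem hn hx hy' fun r ↦ by
    obtain ⟨s, hs, hsr⟩ := γ'.exists_mem_semigroup_mod_eq hn r
    obtain ⟨P, hP⟩ := (γ'.mem_semigroup_iff hγ' s).mp hs
    exact ⟨P, s, hP, hsr⟩
  have hx0 : PowerSeries.constantCoeff x = 0 := by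
    rw [← PowerSeries.order_ne_zero_iff_constCoeff_eq_zero, hx]
    exact_mod_cast hn.ne'
  have hb := h.blowup hx c
  have h₁ : ∀ k, γ'.countingFunction k =
      ∑ i ∈ Finset.range n, ((k - b i + (n - 1)) / n).toNat := by
    intro k
    simp only [countingFunction, γ'.mem_semigroup_iff hγ', h.exists_order_eq_iff hn hx hy']
    exact ncard_progressions hn b h.inj k
  have h₂ : ∀ k, γ.countingFunction k =
      ∑ i ∈ Finset.range n, ((k - (b i + n * i : ℕ) + (n - 1)) / n).toNat := by
    intro k
    simp only [countingFunction, γ.mem_semigroup_iff hγ,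
      hb.exists_order_eq_iff hn hx (by rw [map_mul, hx0, zero_mul])]
    exact ncard_progressions hn _ hb.inj k
  funext k
  rw [h₂, sum_progressions_eq_minConv hn b h.lt, funext h₁]

theorem IsBlowup.countingFunction_eq {γ γ' : PlaneBranch} (hb : IsBlowup γ γ')
    (h : 0 < γ.multiplicity) :
    γ.countingFunction = minConv (multiplicityCost γ.multiplicity) γ'.countingFunction := by
  have hle : ∀ f g : PowerSeries ℂ, f.order ≤ (f * g).order := fun f g ↦ by
    rw [PowerSeries.order_mul]
    exact le_self_add
  rcases hb with ⟨c, hx, hy⟩ | ⟨c, hy, hx⟩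
  · refine countingFunction_eq_minConv γ γ' (c := c) h (x := γ.x) (y' := γ'.y) ?_ γ'.y_zero
      (by rw [← hy]) (by rw [hx])
    exact (ENat.toNat_eq_iff h.ne').mp (by rw [multiplicity, hy, min_eq_left (hle _ _)])
  · refine countingFunction_eq_minConv γ γ' (c := c) h (x := γ.y) (y' := γ'.x) ?_ γ'.x_zero
      (by rw [← hx, Set.pair_comm]) (by rw [hy, Set.pair_comm])
    exact (ENat.toNat_eq_iff h.ne').mp (by rw [multiplicity, hx, min_eq_right (hle _ _)])

theorem HasMultiplicitySequence.countingFunction_eq {γ : PlaneBranch} {l : List ℕ}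
    (h : γ.HasMultiplicitySequence l) : γ.countingFunction = multisetCountingFunction l := by
  induction h with
  | smooth γ h =>
    rw [γ.countingFunction_of_multiplicity_eq_one h, Multiset.coe_nil,
      multisetCountingFunction_zero]
  | blowup γ γ' l h hb _ ih =>
    rw [hb.countingFunction_eq (by omega), ih, ← Multiset.cons_coe, multisetCountingFunction_cons]

end PlaneBranch

theorem theorem5 (ν ν' : ℕ)
    (C : Fin (ν + 1) → PlaneBranch) (C' : Fin (ν' + 1) → PlaneBranch)
    (m : Fin (ν + 1) → List ℕ) (m' : Fin (ν' + 1) → List ℕ)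
    (hm : ∀ i, (C i).HasMultiplicitySequence (m i))
    (hm' : ∀ i, (C' i).HasMultiplicitySequence (m' i))
    (h : ∑ i, (m i : Multiset ℕ) = ∑ i, (m' i : Multiset ℕ)) :
    iteratedMinConv ν (fun i => (C i).countingFunction) =
      iteratedMinConv ν' (fun i => (C' i).countingFunction) := by
  rw [iteratedMinConv_eq_multisetCountingFunction ν _ (fun i ↦ (m i : Multiset ℕ))
      fun i ↦ (hm i).countingFunction_eq,
    iteratedMinConv_eq_multisetCountingFunction ν' _ (fun i ↦ (m' i : Multiset ℕ))
      fun i ↦ (hm' i).countingFunction_eq, h]
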